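/- A triple system (3-uniform hypergraph) on a vertex set $V$ is a collection of 3-element subsets of $V$, called edges. Let $K_t^3$ be the complete triple system on $t$ vertices, let $K_5^{3-}$ be the triple system on five vertices obtained from $K_5^3$ by deleting one edge, and let $C_5^3$ be the tight cycle with vertex set $\mathbb{Z}/5$ and edges $\{i,i+1,i+2\}$, $i\in\mathbb{Z}/5$. For triple systems $F,G$, let $r(F,G)$ be the minimum $n$ such that every red/blue coloring of the edges of $K_n^3$ contains a red copy of $F$ or a blue copy of $G$. Then $$r(K_5^{3-},K_t^3)=2^{O(t^2\log t)},$$ that is, there is a constant $C>0$ such that for every integer $t\ge 2$ the number $r(K_5^{3-},K_t^3)$ exists and satisfies $$r(K_5^{3-},K_t^3)\le 2^{C t^2\log t}.$$ Moreover, $C_5^3\subset K_5^{3-}$ (that is, $K_5^{3-}$ contains a copy of $C_5^3$), and there is a constant $b>0$ such that for every integer $t\ge 2$ the number $r(C_5^3,K_t^3)$ exists and satisfies $$r(C_5^3,K_t^3)<2^{b t^2\log t}.$$ -/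

import Mathlib

/-- A `k`-uniform hypergraph on the vertex set `V`: a collection of `k`-element subsets of `V`. -/
structure UniformHypergraph (k : ℕ) (V : Type) where
  edges : Set (Finset V)
  uniform : ∀ e ∈ edges, e.card = k

namespace UniformHypergraph

/-- The complete `k`-uniform hypergraph `K_n^k` on the `n` vertices of `Fin n`. -/
def complete (k n : ℕ) : UniformHypergraph k (Fin n) where
  edges := {e | e.card = k}
  uniform := fun _ he => he

/-- The hypergraph obtained by deleting the single edge `e₀` (no vertex is deleted). -/
def deleteEdge {k : ℕ} {V : Type} (H : UniformHypergraph k V) (e₀ : Finset V) :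
    UniformHypergraph k V where
  edges := H.edges \ {e₀}
  uniform := fun e he => H.uniform e he.1

/-- `K_5^{3-}`: the complete triple system on five vertices with one edge deleted. -/
def K5minus : UniformHypergraph 3 (Fin 5) :=
  (complete 3 5).deleteEdge {2, 3, 4}

/-- The tight cycle `C_s^k` (for `s ≥ k`): the vertex set is `ℤ/s` and the edges are the sets
`{i, i+1, …, i+k-1}`. For `s ≥ k` the cardinality condition holds automatically. -/
def tightCycle (k s : ℕ) : UniformHypergraph k (ZMod s) where
  edges := {e | e.card = k ∧
    ∃ i : ZMod s, e = (Finset.range k).image (fun j : ℕ => i + (j : ZMod s))}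
  uniform := fun _ he => he.1

/-- `F ⊂ G`: there is a copy of `F` inside `G`. -/
def IsContainedIn {k : ℕ} {V W : Type} (F : UniformHypergraph k V)
    (G : UniformHypergraph k W) : Prop :=
  ∃ f : V ↪ W, ∀ e ∈ F.edges, e.map f ∈ G.edges

/-- The two colors. -/
inductive EdgeColor : Type
  | red
  | blue

/-- A red/blue coloring of (the edges of) `K_n^k`. -/
abbrev Coloring (k n : ℕ) : Type := {e : Finset (Fin n) // e.card = k} → EdgeColor

/-- The coloring `c` of `K_n^k` has a monochromatic copy of `F` in color `x`. -/
def HasMonoCopy {k n : ℕ} {V : Type} (c : Coloring k n) (x : EdgeColor)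
    (F : UniformHypergraph k V) : Prop :=
  ∃ f : V ↪ Fin n, ∀ (e : Finset V) (he : e ∈ F.edges),
    c ⟨e.map f, (Finset.card_map f).trans (F.uniform e he)⟩ = x

/-- Every red/blue coloring of `K_n^k` has a red copy of `F` or a blue copy of `G`. -/
def Arrows {k : ℕ} {V W : Type} (n : ℕ) (F : UniformHypergraph k V)
    (G : UniformHypergraph k W) : Prop :=
  ∀ c : Coloring k n, HasMonoCopy c EdgeColor.red F ∨ HasMonoCopy c EdgeColor.blue G

/-- The Ramsey number `r(F, G)`: the minimum `n` such that every red/blue coloring of `K_n^k` has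
a red copy of `F` or a blue copy of `G`. -/
noncomputable def ramseyNumber {k : ℕ} {V W : Type} (F : UniformHypergraph k V)
    (G : UniformHypergraph k W) : ℕ :=
  sInf {n : ℕ | Arrows n F G}

end UniformHypergraph

/-! Vertices are inserted one at a time into a binary tree while a set `A` of candidates shrinks, so
that a triple consisting of a node w, a node v below it, and a vertex below v or in `A` has the
color of the step from w towards v. Branches are then chains. In a chain the vertices left by blue
steps span a blue clique, so there are fewer than t of them; two vertices left by red steps,
followed by any three vertices, span a red `K5minus` whose missing edge is the final triple.

These two restrictions leave room for at most 3t² nodes while `A` is nonempty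
(`Compatible.size_le`), and every descent makes at most 3 red and t blue steps. Going red only if
this keeps a proportion 1/(2t) of `A`, an insertion costs a factor of at most 32t³
(`Compatible.exists_insert`). So (32t³)^(3t²+1) vertices would allow 3t²+1 insertions, a
contradiction. The bound for the tight cycle follows by containment. -/

namespace UniformHypergraph

/-- A sequence of directed vertices, latest first, in which the color of every triple is the
direction of its earliest vertex (`true` stands for red). -/
def IsChain {V : Type} [DecidableEq V] (col : Finset V → Bool) (l : List (V × Bool)) : Prop :=
  (l.map Prod.fst).Nodup ∧
    ∀ p q r : V × Bool, [p, q, r].Sublist l → col {p.1, q.1, r.1} = r.2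

section Chain

variable {V : Type} [DecidableEq V] {col : Finset V → Bool}

theorem IsChain.sublist {l m : List (V × Bool)} (h : IsChain col l) (hm : m.Sublist l) :
    IsChain col m :=
  ⟨h.1.sublist (hm.map _), fun p q r hs => h.2 p q r (hs.trans hm)⟩

theorem triple_sublist_cons {α : Type} {p q r x : α} {l : List α} :
    [p, q, r].Sublist (x :: l) ↔ [p, q, r].Sublist l ∨ (p = x ∧ [q, r].Sublist l) := by
  rw [List.sublist_cons_iff]
  aesop

theorem pair_sublist_cons {α : Type} {q r x : α} {l : List α} :
    [q, r].Sublist (x :: l) ↔ [q, r].Sublist l ∨ (q = x ∧ r ∈ l) := by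
  rw [List.sublist_cons_iff]
  aesop

/-- Only {x, v, w} has no vertex in `l`; each other triple lies in one of the three given chains.
The directions `i` are placeholders: neither of the two latest entries is ever the earliest of a
triple. -/
theorem IsChain.insert {l : List (V × Bool)} {x v w : V} {k i : Bool}
    (h₁ : IsChain col ((x, i) :: (v, i) :: l)) (h₂ : IsChain col ((x, i) :: (w, i) :: l))
    (h₃ : IsChain col ((v, i) :: (w, i) :: l)) (hk : col {x, v, w} = k) :
    IsChain col ((x, i) :: (v, i) :: (w, k) :: l) := by
  obtain ⟨n₁, c₁⟩ := h₁
  obtain ⟨n₂, c₂⟩ := h₂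
  obtain ⟨n₃, c₃⟩ := h₃
  refine ⟨?_, ?_⟩
  · simp only [List.map_cons, List.nodup_cons, List.mem_cons, not_or] at n₁ n₂ n₃ ⊢
    tauto
  · intro p q r hs
    simp only [triple_sublist_cons, pair_sublist_cons, List.mem_cons] at hs c₁ c₂ c₃
    rcases hs with ((hs | ⟨rfl, hs⟩) | ⟨rfl, hs | ⟨rfl, hs⟩⟩) | ⟨rfl, (hs | ⟨rfl, hs⟩) | ⟨rfl, rfl | hs⟩⟩
    · exact c₁ _ _ _ (Or.inl (Or.inl hs))
    · exact c₂ (w, i) _ _ (Or.inl (Or.inr ⟨rfl, hs⟩))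
    · exact c₁ _ _ _ (Or.inl (Or.inr ⟨rfl, hs⟩))
    · exact c₃ _ (w, i) _ (Or.inr ⟨rfl, Or.inr ⟨rfl, hs⟩⟩)
    · exact c₁ _ _ _ (Or.inr ⟨rfl, Or.inl hs⟩)
    · exact c₂ _ (w, i) _ (Or.inr ⟨rfl, Or.inr ⟨rfl, hs⟩⟩)
    · exact hk
    · exact c₁ _ _ _ (Or.inr ⟨rfl, Or.inr ⟨rfl, hs⟩⟩)

end Chain

/-! ### Color trees and the insertion of a vertex -/

/-- Binary trees with nodes labelled by vertices; the first subtree is the blue one. -/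
inductive ColorTree (V : Type) : Type
  | leaf : ColorTree V
  | node (w : V) (L R : ColorTree V) : ColorTree V

namespace ColorTree

variable {V : Type}

/-- The number of nodes. -/
def size : ColorTree V → ℕ
  | leaf => 0
  | node _ L R => 1 + L.size + R.size

/-- The maximal number of red steps on a branch. -/
def redHeight : ColorTree V → ℕ
  | leaf => 0
  | node _ L R => max L.redHeight (R.redHeight + 1)

/-- The maximal number of blue steps on a branch. -/
def blueHeight : ColorTree V → ℕ
  | leaf => 0
  | node _ L R => max (L.blueHeight + 1) R.blueHeight

/-- Below the chain `l`, every branch of the tree followed by an element of `S` is a chain. -/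
def Compatible [DecidableEq V] (col : Finset V → Bool) (S : Finset V) :
    List (V × Bool) → ColorTree V → Prop
  | _, leaf => True
  | l, node w L R => (∀ x ∈ S, IsChain col ((x, true) :: (w, true) :: l)) ∧
      Compatible col S ((w, false) :: l) L ∧ Compatible col S ((w, true) :: l) R

variable [DecidableEq V] {col : Finset V → Bool}

theorem Compatible.mono {S S' : Finset V} (hS : S' ⊆ S) {T : ColorTree V} :
    ∀ {l : List (V × Bool)}, Compatible col S l T → Compatible col S' l T := by
  induction T with
  | leaf => intro l _; trivial
  | node w L R ihL ihR =>
    intro l h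
    exact ⟨fun x hx => h.1 x (hS hx), ihL h.2.1, ihR h.2.2⟩

/-- The vertex v descends from the root; at a node w it goes red if at least a proportion p of `A`
is red with v and w, otherwise blue, and only the agreeing candidates stay. `S` remains fixed
because v must belong to it, while `A` shrinks along the descent. -/
theorem Compatible.exists_insert {S : Finset V} {v : V} (hv : v ∈ S) {p : ℝ} (hp₀ : 0 ≤ p)
    (hp₁ : p ≤ 1) {T : ColorTree V} :
    ∀ {l : List (V × Bool)} {A : Finset V}, Compatible col S l T → A ⊆ S →
      (∀ x ∈ A, IsChain col ((x, true) :: (v, true) :: l)) →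
      ∃ T' : ColorTree V, ∃ A' ⊆ A, Compatible col A' l T' ∧ T'.size = T.size + 1 ∧
        (A.card : ℝ) * (p ^ T.redHeight * (1 - p) ^ T.blueHeight) ≤ A'.card := by
  have hq₀ : 0 ≤ 1 - p := by linarith
  have hq₁ : 1 - p ≤ 1 := by linarith
  induction T with
  | leaf =>
    intro l A _ _ hA
    exact ⟨node v leaf leaf, A, subset_rfl, ⟨hA, trivial, trivial⟩, by simp [size],
      by simp [redHeight, blueHeight]⟩
  | node w L R ihL ihR =>
    intro l A hT hAS hA
    have hchain (k : Bool) : ∀ x ∈ A.filter (fun x => col {x, v, w} = k),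
        IsChain col ((x, true) :: (v, true) :: (w, k) :: l) := by
      intro x hx
      rw [Finset.mem_filter] at hx
      exact (hA x hx.1).insert (hT.1 x (hAS hx.1)) (hT.1 v hv) hx.2
    have hsub (k : Bool) : A.filter (fun x => col {x, v, w} = k) ⊆ A := Finset.filter_subset _ _
    have hcard : ((A.filter (fun x => col {x, v, w} = true)).card : ℝ) +
        (A.filter (fun x => col {x, v, w} = false)).card = A.card := by
      have := Finset.card_filter_add_card_filter_not (s := A) (fun x => col {x, v, w} = true)
      simp only [Bool.not_eq_true] at this
      exact_mod_cast this
    by_cases hred : (A.card : ℝ) * p ≤ (A.filter (fun x => col {x, v, w} = true)).card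
    · obtain ⟨R', A', hA', hc, hs, hb⟩ := ihR hT.2.2 ((hsub true).trans hAS) (hchain true)
      refine ⟨node w L R', A', hA'.trans (hsub _),
        ⟨fun x hx => hT.1 x (hAS (hsub _ (hA' hx))),
          hT.2.1.mono ((hA'.trans (hsub _)).trans hAS), hc⟩, by simp only [size]; omega,
        le_trans ?_ hb⟩
      calc (A.card : ℝ) * (p ^ (node w L R).redHeight * (1 - p) ^ (node w L R).blueHeight)
          ≤ A.card * (p ^ (R.redHeight + 1) * (1 - p) ^ R.blueHeight) := by
            gcongr ?_ * (?_ * ?_)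
            · exact pow_le_pow_of_le_one hp₀ hp₁ (le_max_right _ _)
            · exact pow_le_pow_of_le_one hq₀ hq₁ (le_max_right _ _)
        _ = (A.card * p) * (p ^ R.redHeight * (1 - p) ^ R.blueHeight) := by ring
        _ ≤ _ := by gcongr
    · have hblue : (A.card : ℝ) * (1 - p) ≤ (A.filter (fun x => col {x, v, w} = false)).card := by
        linarith
      obtain ⟨L', A', hA', hc, hs, hb⟩ := ihL hT.2.1 ((hsub false).trans hAS) (hchain false)
      refine ⟨node w L' R, A', hA'.trans (hsub _),
        ⟨fun x hx => hT.1 x (hAS (hsub _ (hA' hx))), hc,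
          hT.2.2.mono ((hA'.trans (hsub _)).trans hAS)⟩, by simp only [size]; omega,
        le_trans ?_ hb⟩
      calc (A.card : ℝ) * (p ^ (node w L R).redHeight * (1 - p) ^ (node w L R).blueHeight)
          ≤ A.card * (p ^ L.redHeight * (1 - p) ^ (L.blueHeight + 1)) := by
            gcongr ?_ * (?_ * ?_)
            · exact pow_le_pow_of_le_one hp₀ hp₁ (le_max_left _ _)
            · exact pow_le_pow_of_le_one hq₀ hq₁ (le_max_left _ _)
        _ = (A.card * (1 - p)) * (p ^ L.redHeight * (1 - p) ^ L.blueHeight) := by ring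
        _ ≤ _ := by gcongr

/-- The number of entries of `l` with direction `k`. -/
def directionCount {V : Type} (k : Bool) (l : List (V × Bool)) : ℕ := (l.map Prod.snd).count k

theorem directionCount_cons {V : Type} (k i : Bool) (w : V) (l : List (V × Bool)) :
    directionCount k ((w, i) :: l) = directionCount k l + if i = k then 1 else 0 := by
  cases i <;> cases k <;> simp [directionCount]

/-! ### Bounds on the size and heights of a tree -/

section Bounds

variable {S : Finset V} {t : ℕ}

theorem Compatible.directionCount_false_lt {w : V} {L R : ColorTree V} {l : List (V × Bool)}
    (hS : S.Nonempty) (hblue : ∀ l, IsChain col l → directionCount false l < t)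
    (h : Compatible col S l (node w L R)) : directionCount false l < t := by
  obtain ⟨x, hx⟩ := hS
  exact hblue l ((h.1 x hx).sublist (by simp))

theorem Compatible.blueHeight_le (hS : S.Nonempty)
    (hblue : ∀ l, IsChain col l → directionCount false l < t) {T : ColorTree V} :
    ∀ {l : List (V × Bool)}, Compatible col S l T → T.blueHeight ≤ t - directionCount false l := by
  induction T with
  | leaf => intro l _; simp [blueHeight]
  | node w L R ihL ihR =>
    intro l h
    have hL := ihL h.2.1
    have hR := ihR h.2.2
    -- A node forces the truncated difference to be positive, so a blue step really lowers it.
    have := h.directionCount_false_lt hS hblue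
    simp only [directionCount_cons, reduceIte, reduceCtorEq] at hL hR
    simp only [blueHeight]
    omega

/-- A node here, the entry z and a candidate from `S` would be three vertices after two red steps.
-/
theorem Compatible.eq_leaf (hS : S.Nonempty)
    (hred : ∀ x y z l, IsChain col (x :: y :: z :: l) → directionCount true l < 2)
    {T : ColorTree V} {z : V × Bool} {l : List (V × Bool)} (h : Compatible col S (z :: l) T)
    (hl : 2 ≤ directionCount true l) : T = leaf := by
  cases T with
  | leaf => rfl
  | node w L R =>
    obtain ⟨x, hx⟩ := hS
    have := hred _ _ _ _ (h.1 x hx)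
    omega

theorem Compatible.size_le_one (hS : S.Nonempty)
    (hred : ∀ x y z l, IsChain col (x :: y :: z :: l) → directionCount true l < 2)
    {T : ColorTree V} {l : List (V × Bool)} (h : Compatible col S l T)
    (hl : 2 ≤ directionCount true l) : T.size ≤ 1 ∧ T.redHeight ≤ 1 := by
  cases T with
  | leaf => simp [size, redHeight]
  | node w L R =>
    obtain rfl := h.2.1.eq_leaf hS hred hl
    obtain rfl := h.2.2.eq_leaf hS hred hl
    simp [size, redHeight]

/-- Each node on the all-blue path carries a red subtree with at most one node, since two red steps
lead into it. -/
theorem Compatible.size_le_of_one_le (hS : S.Nonempty)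
    (hblue : ∀ l, IsChain col l → directionCount false l < t)
    (hred : ∀ x y z l, IsChain col (x :: y :: z :: l) → directionCount true l < 2)
    {T : ColorTree V} : ∀ {l : List (V × Bool)}, Compatible col S l T →
      1 ≤ directionCount true l →
      T.size ≤ 2 * (t - directionCount false l) ∧ T.redHeight ≤ 2 := by
  induction T with
  | leaf => intro l _ _; simp [size, redHeight]
  | node w L R ihL _ =>
    intro l h hl
    have hL := ihL h.2.1 (by rw [directionCount_cons]; omega)
    have hR := h.2.2.size_le_one hS hred (by rw [directionCount_cons, if_pos rfl]; omega)
    have := h.directionCount_false_lt hS hblue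
    simp only [directionCount_cons, reduceIte] at hL
    simp only [size, redHeight]
    omega

/-- Each node on the all-blue path contributes itself and a red subtree with at most 2t nodes, hence
at most 3t. -/
theorem Compatible.size_le (hS : S.Nonempty)
    (hblue : ∀ l, IsChain col l → directionCount false l < t)
    (hred : ∀ x y z l, IsChain col (x :: y :: z :: l) → directionCount true l < 2)
    {T : ColorTree V} : ∀ {l : List (V × Bool)}, Compatible col S l T →
      T.size ≤ 3 * t * (t - directionCount false l) ∧ T.redHeight ≤ 3 := by
  induction T with
  | leaf => intro l _; simp [size, redHeight]
  | node w L R ihL _ =>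
    intro l h
    have hL := ihL h.2.1
    have hR := h.2.2.size_le_of_one_le hS hblue hred (by rw [directionCount_cons, if_pos rfl]; omega)
    have hlt := h.directionCount_false_lt hS hblue
    obtain ⟨d, hd⟩ : ∃ d, t - directionCount false l = d + 1 :=
      ⟨t - directionCount false l - 1, by omega⟩
    have hd' : t - (directionCount false l + 1) = d := by omega
    simp only [directionCount_cons, reduceIte, hd', reduceCtorEq, add_zero, hd] at hL hR
    simp only [size, redHeight, hd, mul_add, mul_one]
    omega

end Bounds

/-- The exponent `m` is the reserve for further insertions; each spends one factor 32t³, of which 2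
pays for removing v from `A` and 16t³ for its descent. -/
theorem exists_compatible_of_card {S : Finset V} {t : ℕ} (ht : 2 ≤ t)
    (hblue : ∀ l, IsChain col l → directionCount false l < t)
    (hred : ∀ x y z l, IsChain col (x :: y :: z :: l) → directionCount true l < 2) (m n : ℕ)
    (hS : (32 * t ^ 3) ^ (m + n) ≤ S.card) :
    ∃ T : ColorTree V, ∃ A : Finset V, Compatible col A [] T ∧ T.size = n ∧
      (32 * t ^ 3) ^ m ≤ A.card := by
  induction n generalizing m with
  | zero => exact ⟨leaf, S, trivial, rfl, hS⟩
  | succ n ih =>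
    obtain ⟨T, A, hT, hn, hA⟩ := ih (m + 1) (by rwa [add_right_comm, add_assoc])
    have htpos : 0 < t := by omega
    have hpow : 0 < (32 * t ^ 3) ^ m := by positivity
    have hbase : 2 ≤ 32 * t ^ 3 := by
      have : 0 < t ^ 3 := by positivity
      omega
    have hA₂ : 2 ≤ A.card := by
      rw [pow_succ] at hA
      nlinarith
    obtain ⟨v, hv⟩ : A.Nonempty := Finset.card_pos.1 (by omega)
    have hp₁ : (1 : ℝ) / (2 * t) ≤ 1 := by
      rw [div_le_one (by positivity)]
      have : (2 : ℝ) ≤ t := by exact_mod_cast ht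
      linarith
    have hp₀ : (0 : ℝ) ≤ 1 / (2 * t) := by positivity
    obtain ⟨T', A', -, hT', hsize, hcard⟩ := hT.exists_insert hv hp₀ hp₁ (A := A.erase v)
      (Finset.erase_subset _ _) (fun x hx =>
        ⟨by simpa using (Finset.mem_erase.1 hx).1, fun p q r hs => by
          have := hs.length_le
          simp at this⟩)
    refine ⟨T', A', hT', by omega, ?_⟩
    have hA₀ : A.Nonempty := ⟨v, hv⟩
    have hq₁ : 1 - 1 / (2 * (t : ℝ)) ≤ 1 := by linarith
    -- With p = 1/(2t), Bernoulli's inequality shows that t blue steps together lose at most half.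
    have hbern : (1 / 2 : ℝ) ≤ (1 - 1 / (2 * t)) ^ t := by
      have h := one_add_mul_le_pow (a := -(1 / (2 * (t : ℝ)))) (by linarith) t
      have he : (t : ℝ) * (1 / (2 * t)) = 1 / 2 := by field_simp
      rw [← sub_eq_add_neg] at h
      linarith
    have hloss : 1 / (16 * (t : ℝ) ^ 3) ≤
        (1 / (2 * t)) ^ T.redHeight * (1 - 1 / (2 * t)) ^ T.blueHeight := by
      calc 1 / (16 * (t : ℝ) ^ 3) = (1 / (2 * (t : ℝ))) ^ 3 * (1 / 2) := by
            field_simp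
            norm_num
        _ ≤ (1 / (2 * (t : ℝ))) ^ 3 * (1 - 1 / (2 * (t : ℝ))) ^ t := by gcongr
        _ ≤ (1 / (2 * (t : ℝ))) ^ T.redHeight * (1 - 1 / (2 * (t : ℝ))) ^ T.blueHeight := by
          gcongr ?_ * ?_
          · exact pow_le_pow_of_le_one hp₀ hp₁ (hT.size_le hA₀ hblue hred).2
          · exact pow_le_pow_of_le_one (by linarith) hq₁
              ((hT.blueHeight_le hA₀ hblue).trans (Nat.sub_le _ _))
    have hhalf : (A.card : ℝ) / 2 ≤ (A.erase v).card := by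
      have h : A.card ≤ 2 * (A.erase v).card := by
        rw [Finset.card_erase_of_mem hv]
        omega
      have : (A.card : ℝ) ≤ 2 * (A.erase v).card := by exact_mod_cast h
      linarith
    have hfinal : (((32 * t ^ 3) ^ m : ℕ) : ℝ) ≤ A'.card := by
      calc (((32 * t ^ 3) ^ m : ℕ) : ℝ)
          = (((32 * t ^ 3) ^ (m + 1) : ℕ) : ℝ) / 2 * (1 / (16 * (t : ℝ) ^ 3)) := by
            push_cast
            field_simp
            ring
        _ ≤ (A.card : ℝ) / 2 * (1 / (16 * (t : ℝ) ^ 3)) := by gcongr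
        _ ≤ (A.erase v).card * ((1 / (2 * t)) ^ T.redHeight *
              (1 - 1 / (2 * t)) ^ T.blueHeight) := by gcongr
        _ ≤ A'.card := hcard
    exact_mod_cast hfinal

end ColorTree

/-! ### Monochromatic copies from chains, and the Ramsey bound -/

theorem exists_mono_complete {n t : ℕ} {c : Coloring 3 n} {col : Finset (Fin n) → Bool}
    (hcol : ∀ e (he : e.card = 3), c ⟨e, he⟩ = if col e then EdgeColor.red else EdgeColor.blue)
    {l : List (Fin n × Bool)} (hl : IsChain col l) (ht : t ≤ ColorTree.directionCount false l) :
    HasMonoCopy c EdgeColor.blue (complete 3 t) := by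
  set m := l.filter (fun p => p.2 = false) with hm
  have hmc : IsChain col m := hl.sublist List.filter_sublist
  have hlen : t ≤ m.length := by
    refine ht.trans (le_of_eq ?_)
    rw [ColorTree.directionCount, hm, List.count, List.countP_map, List.countP_eq_length_filter]
    congr 2
  have hdir : ∀ p ∈ m, p.2 = false := by
    intro p hp
    simpa using (List.mem_filter.1 hp).2
  have hinj : Function.Injective (fun i : Fin t => (m[i.1]'(i.2.trans_le hlen)).1) := by
    intro i j hij
    have := hmc.1.getElem_inj_iff (i := i.1) (j := j.1)
      (hi := by simpa using i.2.trans_le hlen) (hj := by simpa using j.2.trans_le hlen)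
    simp only [List.getElem_map] at this
    exact Fin.ext (this.1 hij)
  refine ⟨⟨_, hinj⟩, fun e he => ?_⟩
  have he' : e.card = 3 := he
  set g := e.orderEmbOfFin he'
  have heg : e = {g 0, g 1, g 2} := by
    rw [← Finset.image_orderEmbOfFin_univ e he']
    ext a
    simp only [Finset.mem_image, Finset.mem_univ, true_and, Fin.exists_fin_succ, Finset.mem_insert,
      Finset.mem_singleton, g, eq_comm (b := a)]
    simp
  have hlt₁ : (g 0).1 < (g 1).1 := g.strictMono (by decide)
  have hlt₂ : (g 1).1 < (g 2).1 := g.strictMono (by decide)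
  have hsub := List.map_getElem_sublist (l := m)
    (is := [⟨g 0, (g 0).2.trans_le hlen⟩, ⟨g 1, (g 1).2.trans_le hlen⟩,
      ⟨g 2, (g 2).2.trans_le hlen⟩]) (by simp [hlt₁, hlt₂, hlt₁.trans hlt₂])
  have hc := (hmc.2 _ _ _ hsub).trans (hdir _ (List.getElem_mem _))
  rw [hcol, if_neg]
  rw [heg]
  simpa [Finset.map_insert] using hc

theorem exists_mono_K5minus {n : ℕ} {c : Coloring 3 n} {col : Finset (Fin n) → Bool}
    (hcol : ∀ e (he : e.card = 3), c ⟨e, he⟩ = if col e then EdgeColor.red else EdgeColor.blue)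
    {x y z : Fin n × Bool} {l : List (Fin n × Bool)} (hl : IsChain col (x :: y :: z :: l))
    (h2 : 2 ≤ ColorTree.directionCount true l) : HasMonoCopy c EdgeColor.red K5minus := by
  obtain ⟨a, b, hab⟩ : ∃ a b : Fin n, [(b, true), (a, true)].Sublist l := by
    have hs : (List.replicate 2 true).Sublist (l.map Prod.snd) :=
      List.replicate_sublist_iff.2 h2
    obtain ⟨l', hl', he⟩ := List.sublist_map_iff.1 hs
    obtain ⟨p, q, rfl⟩ : ∃ p q, l' = [p, q] :=
      List.length_eq_two.1 (by simpa using (congrArg List.length he).symm)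
    simp only [List.replicate, List.map_cons, List.map_nil, List.cons.injEq, and_true] at he
    obtain ⟨b, i⟩ := p
    obtain ⟨a, j⟩ := q
    obtain ⟨rfl, rfl⟩ : true = i ∧ true = j := he
    exact ⟨a, b, hl'⟩
  obtain ⟨hn, hc⟩ := hl.sublist (((hab.cons_cons z).cons_cons y).cons_cons x)
  -- Vertices 0 and 1 go to the two red-directed entries, so the deleted edge {2, 3, 4} goes to the
  -- three latest vertices, whose triple is uncontrolled.
  have hinj : Function.Injective ![a, b, z.1, y.1, x.1] := by
    rw [← List.nodup_ofFn, ← List.nodup_reverse]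
    simpa [List.ofFn_succ] using hn
  refine ⟨⟨_, hinj⟩, fun e he => ?_⟩
  have hcases : ∀ e : Finset (Fin 5), e.card = 3 → e ≠ {2, 3, 4} →
      e = {4, 3, 1} ∨ e = {4, 3, 0} ∨ e = {4, 2, 1} ∨ e = {4, 2, 0} ∨ e = {4, 1, 0} ∨
      e = {3, 2, 1} ∨ e = {3, 2, 0} ∨ e = {3, 1, 0} ∨ e = {2, 1, 0} := by decide
  have hred : ∀ p q r : Fin n × Bool, [p, q, r].Sublist [x, y, z, (b, true), (a, true)] →
      r.2 = true → col {p.1, q.1, r.1} = true := fun p q r h hr => (hc p q r h).trans hr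
  rw [hcol, if_pos]
  simp only [triple_sublist_cons, pair_sublist_cons] at hred
  rcases hcases e he.1 he.2 with rfl | rfl | rfl | rfl | rfl | rfl | rfl | rfl | rfl
  · simpa [Finset.map_insert] using hred x y (b, true) (by simp) rfl
  · simpa [Finset.map_insert] using hred x y (a, true) (by simp) rfl
  · simpa [Finset.map_insert] using hred x z (b, true) (by simp) rfl
  · simpa [Finset.map_insert] using hred x z (a, true) (by simp) rfl
  · simpa [Finset.map_insert] using hred x (b, true) (a, true) (by simp) rfl
  · simpa [Finset.map_insert] using hred y z (b, true) (by simp) rfl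
  · simpa [Finset.map_insert] using hred y z (a, true) (by simp) rfl
  · simpa [Finset.map_insert] using hred y (b, true) (a, true) (by simp) rfl
  · simpa [Finset.map_insert] using hred z (b, true) (a, true) (by simp) rfl

theorem arrows_K5minus_complete {t : ℕ} (ht : 2 ≤ t) :
    Arrows ((32 * t ^ 3) ^ (3 * t ^ 2 + 1)) K5minus (complete 3 t) := by
  classical
  intro c
  by_contra! hcon
  -- Sets that are not triples get the junk value `false`; chains have distinct vertices, so they
  -- never consult it.
  set col : Finset (Fin ((32 * t ^ 3) ^ (3 * t ^ 2 + 1))) → Bool :=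
    fun e => decide (∃ he : e.card = 3, c ⟨e, he⟩ = EdgeColor.red) with hcol_def
  have hcol : ∀ e (he : e.card = 3),
      c ⟨e, he⟩ = if col e then EdgeColor.red else EdgeColor.blue := by
    intro e he
    cases h : c ⟨e, he⟩ <;> simp [hcol_def, he, h]
  have hblue : ∀ l, IsChain col l → ColorTree.directionCount false l < t := fun l hl => by
    by_contra! h
    exact hcon.2 (exists_mono_complete hcol hl h)
  have hred : ∀ x y z l, IsChain col (x :: y :: z :: l) → ColorTree.directionCount true l < 2 :=
    fun x y z l hl => by
      by_contra! h
      exact hcon.1 (exists_mono_K5minus hcol hl h)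
  obtain ⟨T, A, hT, hn, hA⟩ := ColorTree.exists_compatible_of_card (S := Finset.univ) ht hblue hred 0
    (3 * t ^ 2 + 1) (by simp)
  have hne : A.Nonempty := Finset.card_pos.1 (by simpa using hA)
  have := (hT.size_le hne hblue hred).1
  simp only [ColorTree.directionCount, List.map_nil, List.count_nil, Nat.sub_zero] at this
  nlinarith

theorem isContainedIn_tightCycle_K5minus : IsContainedIn (tightCycle 3 5) K5minus := by
  -- This map pulls the deleted edge {2, 3, 4} back to {0, 1, 3}, which is not three consecutive
  -- residues modulo 5.
  have hinj : ∀ a b : Fin 5, (![2, 3, 0, 4, 1] : Fin 5 → Fin 5) a = ![2, 3, 0, 4, 1] b → a = b := by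
    decide
  refine ⟨⟨(![2, 3, 0, 4, 1] : Fin 5 → Fin 5), hinj⟩, ?_⟩
  rintro e ⟨he, i, rfl⟩
  refine ⟨(Finset.card_map _).trans he, ?_⟩
  clear he
  revert i
  decide +revert

theorem HasMonoCopy.of_isContainedIn {k n : ℕ} {V W : Type} {c : Coloring k n} {x : EdgeColor}
    {F : UniformHypergraph k V} {G : UniformHypergraph k W} (h : HasMonoCopy c x G)
    (hFG : F.IsContainedIn G) : HasMonoCopy c x F := by
  obtain ⟨f, hf⟩ := h
  obtain ⟨g, hg⟩ := hFG
  refine ⟨g.trans f, fun e he => ?_⟩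
  have := hf _ (hg e he)
  simpa only [Finset.map_map] using this

theorem Arrows.of_isContainedIn {k n : ℕ} {V V' W : Type} {F : UniformHypergraph k V}
    {F' : UniformHypergraph k V'} {G : UniformHypergraph k W} (h : Arrows n F G)
    (hF : F'.IsContainedIn F) : Arrows n F' G :=
  fun c => (h c).imp_left fun hc => hc.of_isContainedIn hF

theorem Arrows.isLeast_ramseyNumber {k n : ℕ} {V W : Type} {F : UniformHypergraph k V}
    {G : UniformHypergraph k W} (h : Arrows n F G) :
    IsLeast {n : ℕ | Arrows n F G} (ramseyNumber F G) :=
  ⟨Nat.sInf_mem ⟨n, h⟩, fun _ hm => Nat.sInf_le hm⟩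

/-- As 32 ≤ t⁵, the left side is at most t^(24t²+8), and 8 < 9t². Dividing by `Real.log 2` turns the
power of 2 into t^(33t²). -/
theorem ramsey_bound_lt {t : ℕ} (ht : 2 ≤ t) :
    (((32 * t ^ 3) ^ (3 * t ^ 2 + 1) : ℕ) : ℝ) <
      (2 : ℝ) ^ (33 / Real.log 2 * (t : ℝ) ^ 2 * Real.log t) := by
  have hlog2 : 0 < Real.log 2 := Real.log_pos (by norm_num)
  have htpos : (0 : ℝ) < t := by
    have : 0 < t := by omega
    exact_mod_cast this
  have hrhs : (2 : ℝ) ^ (33 / Real.log 2 * (t : ℝ) ^ 2 * Real.log t) = (t : ℝ) ^ (33 * t ^ 2) := by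
    rw [Real.rpow_def_of_pos (by norm_num), ← Real.rpow_natCast t (33 * t ^ 2), Real.rpow_def_of_pos htpos]
    congr 1
    push_cast
    field_simp
  rw [hrhs]
  norm_cast
  calc (32 * t ^ 3) ^ (3 * t ^ 2 + 1) ≤ (t ^ 8) ^ (3 * t ^ 2 + 1) := by
        gcongr
        calc 32 * t ^ 3 = 2 ^ 5 * t ^ 3 := by norm_num
          _ ≤ t ^ 5 * t ^ 3 := by gcongr
          _ = t ^ 8 := by ring
    _ = t ^ (24 * t ^ 2 + 8) := by rw [← pow_mul]; ring_nf
    _ < t ^ (33 * t ^ 2) := Nat.pow_lt_pow_right (by omega) (by nlinarith)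

end UniformHypergraph

theorem mainTheorem2 :
    (∃ C : ℝ, 0 < C ∧ ∀ t : ℕ, 2 ≤ t →
      -- the minimum defining `r(K_5^{3-}, K_t^3)` exists
      IsLeast {n : ℕ | UniformHypergraph.Arrows n UniformHypergraph.K5minus
          (UniformHypergraph.complete 3 t)}
        (UniformHypergraph.ramseyNumber UniformHypergraph.K5minus
          (UniformHypergraph.complete 3 t)) ∧
      (UniformHypergraph.ramseyNumber UniformHypergraph.K5minus
          (UniformHypergraph.complete 3 t) : ℝ)
        ≤ (2 : ℝ) ^ (C * (t : ℝ) ^ 2 * Real.log (t : ℝ))) ∧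
    UniformHypergraph.IsContainedIn (UniformHypergraph.tightCycle 3 5)
      UniformHypergraph.K5minus ∧
    (∃ b : ℝ, 0 < b ∧ ∀ t : ℕ, 2 ≤ t →
      -- the minimum defining `r(C_5^3, K_t^3)` exists
      IsLeast {n : ℕ | UniformHypergraph.Arrows n (UniformHypergraph.tightCycle 3 5)
          (UniformHypergraph.complete 3 t)}
        (UniformHypergraph.ramseyNumber (UniformHypergraph.tightCycle 3 5)
          (UniformHypergraph.complete 3 t)) ∧
      (UniformHypergraph.ramseyNumber (UniformHypergraph.tightCycle 3 5)
          (UniformHypergraph.complete 3 t) : ℝ)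
        < (2 : ℝ) ^ (b * (t : ℝ) ^ 2 * Real.log (t : ℝ))) := by
  
  have hpos : 0 < 33 / Real.log 2 := div_pos (by norm_num) (Real.log_pos (by norm_num))
  refine ⟨⟨_, hpos, fun t ht => ?_⟩, UniformHypergraph.isContainedIn_tightCycle_K5minus,
    ⟨_, hpos, fun t ht => ?_⟩⟩
  · have h := UniformHypergraph.arrows_K5minus_complete ht
    have hle := h.isLeast_ramseyNumber
    exact ⟨hle, (Nat.cast_le.2 (hle.2 h)).trans (UniformHypergraph.ramsey_bound_lt ht).le⟩
  · have h := (UniformHypergraph.arrows_K5minus_complete ht).of_isContainedIn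
      UniformHypergraph.isContainedIn_tightCycle_K5minus
    have hle := h.isLeast_ramseyNumber
    exact ⟨hle, (Nat.cast_le.2 (hle.2 h)).trans_lt (UniformHypergraph.ramsey_bound_lt ht)⟩
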